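/- Let $G$ be a finite nilpotent group, let $p\neq 2$ be a prime, and let $h\in G$ be a non-central element of order $p$. Write $C_n$ for a cyclic group of order $n$, $C_\infty$ for an infinite cyclic group, $\star$ for the free product of groups, and $\mathcal U(\mathbb ZG)$ for the unit group of the integral group ring $\mathbb ZG$. Put $\widetilde h=\sum_{i=0}^{p-1}h^i\in\mathbb ZG$, and let $x\mapsto x^*$ be the $\mathbb Z$-linear involution of $\mathbb ZG$ with $g^*=g^{-1}$ for $g\in G$. Then: (1) A subgroup of $\mathcal U(\mathbb ZG)$ isomorphic to $C_p\star C_\infty$ exists and is given explicitly as follows. There is an element $g\in G$ that does not normalize $\langle h\rangle$; and for every such $g$ the element $$u=h+(1-h)\,g\,\widetilde h$$ is a unit of $\mathbb ZG$ and $$\langle u,\;u^*uu^*\rangle=\langle u\rangle\star\langle u^*uu^*\rangle\cong C_p\star C_\infty ,$$ with $u$ generating the factor $C_p$ and $u^*uu^*$ generating the factor $C_\infty$. (2) There is a unit $w\in\mathcal U(\mathbb ZG)$ such that $\langle h,w\rangle=\langle h\rangle\star\langle w\rangle\cong C_p\star C_\infty$. -/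

import Mathlib

open scoped MonoidAlgebra

noncomputable section

namespace GroupRingUnits

variable {G : Type*} [Group G]

/-- The canonical embedding of `G` into the integral group ring `ℤ[G]`. -/
def emb : G →* ℤ[G] := MonoidAlgebra.of ℤ G

/-- A group element seen as a (trivial) unit of `ℤ[G]`. -/
def trivialUnit : G →* (ℤ[G])ˣ := emb.toHomUnits

/-- The sum in `ℤ[G]` of all elements of the cyclic group generated by an element `h` of
finite order. -/
def cyclicSum (h : G) : ℤ[G] := ∑ i ∈ Finset.range (orderOf h), emb (h ^ i)

theorem cyclicSum_mul_one_sub (h : G) : cyclicSum h * (1 - emb h) = 0 := by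
  have e : cyclicSum h = ∑ i ∈ Finset.range (orderOf h), emb h ^ i := by
    simp [cyclicSum]
  rw [e, ← neg_sub, mul_neg, geom_sum_mul, ← map_pow, pow_orderOf_eq_one, map_one, sub_self,
    neg_zero]

/-- `cyclicSum h` really is the sum over the subgroup generated by `h`. -/
theorem cyclicSum_eq_sum_zpowers [Finite G] (h : G) [Fintype (Subgroup.zpowers h)] :
    cyclicSum h = ∑ x : Subgroup.zpowers h, emb (x : G) := by
  rw [cyclicSum, Finset.sum_range]
  exact Fintype.sum_equiv (finEquivZPowers (isOfFinOrder_of_finite h)) _ _ (fun i => by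
    simp [finEquivZPowers_apply])

theorem cyclicSum_mul_inv_mul (h : G) (k : ℕ) :
    cyclicSum h * emb (h ^ k)⁻¹ * (1 - emb h) = 0 := by
  have c : emb (h ^ k)⁻¹ * (1 - emb h) = (1 - emb h) * emb (h ^ k)⁻¹ := by
    rw [mul_sub, sub_mul, ← map_mul, ← map_mul, mul_one, one_mul]
    congr 2
    exact (((Commute.refl h).pow_left k).inv_left).eq
  rw [mul_assoc, c, ← mul_assoc, cyclicSum_mul_one_sub, zero_mul]

/-- The Bovdi unit `h ^ k + (1 - h) * g * h~` of `ℤ[G]`, where `h~` is the sum of the elements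
of the cyclic group generated by `h`. -/
def bovdiUnit (k : ℕ) (g h : G) : (ℤ[G])ˣ where
  val := emb (h ^ k) + (1 - emb h) * emb g * cyclicSum h
  inv := emb (h ^ k)⁻¹ - emb (h ^ k)⁻¹ * ((1 - emb h) * emb g * cyclicSum h) * emb (h ^ k)⁻¹
  val_inv := by
    have e : emb (h ^ k) * emb (h ^ k)⁻¹ = (1 : ℤ[G]) := by rw [← map_mul]; simp
    have z := cyclicSum_mul_inv_mul h k
    generalize emb (h ^ k) = a at *
    generalize emb (h ^ k)⁻¹ = b at *
    generalize cyclicSum h = c at *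
    generalize 1 - emb h = d at *
    generalize emb g = x at *
    have e1 : a * (b * (d * x * c) * b) = d * x * c * b := by
      rw [← mul_assoc, ← mul_assoc, e, one_mul]
    have e2 : d * x * c * (b * (d * x * c) * b) = 0 := by
      have : d * x * c * (b * (d * x * c) * b) = d * x * (c * b * d) * x * c * b := by noncomm_ring
      rw [this, z]; simp
    rw [mul_sub, add_mul, add_mul, e1, e2, e]; simp
  inv_val := by
    have e : emb (h ^ k)⁻¹ * emb (h ^ k) = (1 : ℤ[G]) := by rw [← map_mul]; simp
    have z := cyclicSum_mul_inv_mul h k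
    generalize emb (h ^ k) = a at *
    generalize emb (h ^ k)⁻¹ = b at *
    generalize cyclicSum h = c at *
    generalize 1 - emb h = d at *
    generalize emb g = x at *
    have e1 : b * (d * x * c) * b * a = b * (d * x * c) := by rw [mul_assoc, e, mul_one]
    have e2 : b * (d * x * c) * b * (d * x * c) = 0 := by
      have : b * (d * x * c) * b * (d * x * c) = b * d * x * (c * b * d) * x * c := by noncomm_ring
      rw [this, z]; simp
    rw [sub_mul, mul_add, mul_add, e1, e2, e]; simp

/-- The classical involution of `ℤ[G]`: the `ℤ`-linear map sending each `g` in `G` to `g⁻¹`. -/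
def involution (x : ℤ[G]) : ℤ[G] := MonoidAlgebra.mapDomain (fun g : G => g⁻¹) x

theorem involution_emb (g : G) : involution (emb g) = emb g⁻¹ := by
  simp [involution, emb]

theorem involution_one : involution (1 : ℤ[G]) = 1 := by
  simpa using involution_emb (1 : G)

theorem involution_mul (x y : ℤ[G]) : involution (x * y) = involution y * involution x := by
  induction x using MonoidAlgebra.induction_linear with
  | zero => simp [involution]
  | add a b ha hb =>
    simp only [involution, add_mul, mul_add, MonoidAlgebra.mapDomain_add] at *
    rw [ha, hb]
  | single a r =>
    induction y using MonoidAlgebra.induction_linear with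
    | zero => simp [involution]
    | add a b ha hb =>
      simp only [involution, add_mul, mul_add, MonoidAlgebra.mapDomain_add] at *
      rw [ha, hb]
    | single b s => simp [involution, MonoidAlgebra.single_mul_single, mul_comm]

/-- The image of a unit under the classical involution, as a unit. -/
def involutionUnit (u : (ℤ[G])ˣ) : (ℤ[G])ˣ where
  val := involution (u : ℤ[G])
  inv := involution ((u⁻¹ : (ℤ[G])ˣ) : ℤ[G])
  val_inv := by rw [← involution_mul, Units.inv_mul, involution_one]
  inv_val := by rw [← involution_mul, Units.mul_inv, involution_one]

/-- The free product of a cyclic group of order `n` (for `n` positive) and an infinite cyclic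
group. -/
abbrev CyclicFreeProduct (n : ℕ) : Type :=
  Monoid.Coprod (Multiplicative (ZMod n)) (Multiplicative ℤ)

/-- The subgroup generated by `a` and `b` is the free product of a cyclic group of order `n`
generated by `a` and an infinite cyclic group generated by `b`. -/
def GenerateFreeProduct {U : Type*} [Group U] (n : ℕ) (a b : U) : Prop :=
  ∃ e : CyclicFreeProduct n ≃* Subgroup.closure ({a, b} : Set U),
    (e (Monoid.Coprod.inl (Multiplicative.ofAdd 1)) : U) = a ∧
    (e (Monoid.Coprod.inr (Multiplicative.ofAdd 1)) : U) = b

end GroupRingUnits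

end

/-!
The free products are detected by ping-pong on a complex projective line.

Let `x` be a nonzero vector of a complex representation of `G` that is fixed by `h`, and suppose
that `y = g x` is an eigenvector of `h` whose eigenvalue `ζ` is a primitive `p`-th root of unity.
Then the plane spanned by `x` and `y` is stable under `h`, under `u = h + (1 - h) g h~` and under
`u^*`. With `c = p (1 - ζ)` they act on coordinates `(α, β)` by
`h : (α, ζ β)`, `u : (α, c α + ζ β)` and `u^* : (α + c̄ β, ζ̄ β)`. Such a vector exists because `G` is
nilpotent: the subgroup generated by `h` and `g⁻¹ h g` has a character that is trivial on `h` and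
equal to `ζ` on `g⁻¹ h g`, since a maximal subgroup containing `h` is normal in it
(`exists_character_of_closure_pair_eq_top`, `exists_eigenvector`).

On slopes `s = β / α` the unit `u` is the rotation by `ζ` around the point `p`, while
`v = u^* u u^*` is a Möbius transformation of determinant of modulus `1` and trace
`(‖c‖ ^ 2 + 1) (1 + ζ̄)`, a number of modulus greater than `2` because
`‖c‖ ^ 2 ‖1 + ζ‖ = (p ‖1 - ζ‖) (p ‖1 - ζ ^ 2‖)` and both factors are greater than `2`
(`two_lt_mul_norm_one_sub`); for the second one `p ≠ 2` is needed. Hence the isometric circles of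
`v` and of `v⁻¹` bound disjoint discs, which both lie in `‖s‖ ≤ 1 / ‖c‖`, and nonzero powers of `v`
map the complement of these discs into them. The nontrivial powers of `u` translate and rotate the
discs away from themselves, so ping-pong applies
(`generateFreeProduct_of_planar_action`, `generateFreeProduct_bovdiUnit`).

The rotation `h` has its centre at slope `0`, but after conjugating it by a unit that acts on slopes
as a large translation the same argument applies, with the same `v`
(`exists_generateFreeProduct_trivialUnit`).
-/

namespace GroupRingUnits

open scoped commutatorElement ComplexConjugate

/-! ### Ping-pong for two generators -/

/-- An injective homomorphism out of the abstract free product exhibits the images of the two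
standard generators as generating a free product: its range is the subgroup they generate. -/
theorem generateFreeProduct_of_injective {U : Type*} [Group U] {n : ℕ} {a b : U}
    (f : CyclicFreeProduct n →* U) (hf : Function.Injective f)
    (ha : f (Monoid.Coprod.inl (Multiplicative.ofAdd 1)) = a)
    (hb : f (Monoid.Coprod.inr (Multiplicative.ofAdd 1)) = b) :
    GenerateFreeProduct n a b := by
  have hinl : ∀ x : Multiplicative (ZMod n), x ∈ Subgroup.zpowers (Multiplicative.ofAdd 1) := by
    intro x
    obtain ⟨k, hk⟩ := ZMod.intCast_surjective (Multiplicative.toAdd x)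
    refine ⟨k, ?_⟩
    change Multiplicative.ofAdd 1 ^ k = x
    rw [← ofAdd_zsmul, zsmul_one, hk, ofAdd_toAdd]
  have hrange : f.range = Subgroup.closure {a, b} := by
    apply le_antisymm
    · rintro _ ⟨x, rfl⟩
      induction x using Monoid.Coprod.induction_on with
      | inl x =>
        obtain ⟨k, rfl⟩ := hinl x
        simp only [map_zpow, ha]
        exact zpow_mem (Subgroup.subset_closure (by simp)) _
      | inr x =>
        have : x = Multiplicative.ofAdd 1 ^ Multiplicative.toAdd x := by
          rw [← ofAdd_zsmul, zsmul_one, Int.cast_id, ofAdd_toAdd]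
        rw [this, map_zpow, map_zpow, hb]
        exact zpow_mem (Subgroup.subset_closure (by simp)) _
      | mul x y hx hy => rw [map_mul]; exact mul_mem hx hy
    · rw [Subgroup.closure_le]
      rintro _ (rfl | rfl)
      · exact ⟨_, ha⟩
      · exact ⟨_, hb⟩
  refine ⟨(MonoidHom.ofInjective hf).trans (MulEquiv.subgroupCongr hrange), ?_, ?_⟩
  · exact ha
  · exact hb

theorem GenerateFreeProduct.conj {U : Type*} [Group U] {n : ℕ} {a b : U}
    (hab : GenerateFreeProduct n a b) (t : U) :
    GenerateFreeProduct n (t * a * t⁻¹) (t * b * t⁻¹) := by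
  obtain ⟨e, ha, hb⟩ := hab
  refine generateFreeProduct_of_injective
    ((MulAut.conj t).toMonoidHom.comp ((Subgroup.subtype _).comp e.toMonoidHom)) ?_ ?_ ?_
  · exact (MulAut.conj t).injective.comp (Subtype.val_injective.comp e.injective)
  · simp [ha]
  · simp [hb]

/-- The two factors `A` and `B` of a binary free product as a family of groups indexed by `Bool`. -/
def BoolFamily (A B : Type) (i : Bool) : Type :=
  match i with
  | true => A
  | false => B

instance (A B : Type) [Group A] [Group B] (i : Bool) : Group (BoolFamily A B i) :=
  match i with
  | true => inferInstanceAs (Group A)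
  | false => inferInstanceAs (Group B)

/-- The canonical map from a binary free product to the free product of the family of its two
factors. -/
def coprodToCoprodI (A B : Type) [Group A] [Group B] :
    Monoid.Coprod A B →* Monoid.CoprodI (BoolFamily A B) :=
  Monoid.Coprod.lift (Monoid.CoprodI.of (M := BoolFamily A B) (i := true))
    (Monoid.CoprodI.of (M := BoolFamily A B) (i := false))

/-- The ping-pong lemma for the free product of two groups, the first of which has at least three
elements. -/
theorem coprod_lift_injective_of_pingPong {A B : Type} {U X : Type*} [Group A] [Group B] [Group U]
    [MulAction U X] (f : A →* U) (k : B →* U) (hA : 3 ≤ Cardinal.mk A) {P Q : Set X}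
    (hP : P.Nonempty) (hQ : Q.Nonempty) (hPQ : Disjoint P Q)
    (hf : ∀ x : A, x ≠ 1 → ∀ z ∈ P, f x • z ∈ Q) (hk : ∀ y : B, y ≠ 1 → ∀ z ∈ Q, k y • z ∈ P) :
    Function.Injective (Monoid.Coprod.lift f k) := by
  let F : ∀ i, BoolFamily A B i →* U := fun i => match i with
    | true => f
    | false => k
  have hF : Function.Injective (Monoid.CoprodI.lift F) := by
    refine Monoid.CoprodI.lift_injective_of_ping_pong F (.inr ⟨true, hA⟩)
      (fun i => bif i then Q else P) ?_ ?_ ?_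
    · rintro (_ | _)
      exacts [hP, hQ]
    · rintro (_ | _) (_ | _) hij
      exacts [absurd rfl hij, hPQ, hPQ.symm, absurd rfl hij]
    · rintro (_ | _) (_ | _) hij x hx
      · exact absurd rfl hij
      · rintro _ ⟨z, hz, rfl⟩
        exact hk x hx z hz
      · rintro _ ⟨z, hz, rfl⟩
        exact hf x hx z hz
      · exact absurd rfl hij
  let toCoprod : ∀ i, BoolFamily A B i →* Monoid.Coprod A B := fun i => match i with
    | true => Monoid.Coprod.inl
    | false => Monoid.Coprod.inr
  have hid : (Monoid.CoprodI.lift toCoprod).comp (coprodToCoprodI A B) = MonoidHom.id _ :=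
    Monoid.Coprod.hom_ext
      (MonoidHom.ext fun x => Monoid.CoprodI.lift_of (i := true) toCoprod x)
      (MonoidHom.ext fun x => Monoid.CoprodI.lift_of (i := false) toCoprod x)
  have hcomp : Monoid.Coprod.lift f k = (Monoid.CoprodI.lift F).comp (coprodToCoprodI A B) :=
    Monoid.Coprod.hom_ext
      (MonoidHom.ext fun x => (Monoid.CoprodI.lift_of (i := true) F x).symm)
      (MonoidHom.ext fun x => (Monoid.CoprodI.lift_of (i := false) F x).symm)
  rw [hcomp]
  exact hF.comp (Function.LeftInverse.injective fun x => DFunLike.congr_fun hid x)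

/-- Ping-pong for two elements: the powers `a ^ i` with `0 < i < n` move `P` into `Q`, and the powers
of `b` with nonzero exponent move `Q` into `P`. -/
theorem generateFreeProduct_of_pingPong {U X : Type*} [Group U] [MulAction U X] {n : ℕ}
    (hn : 3 ≤ n) {a b : U} (ha : a ^ n = 1) {P Q : Set X} (hP : P.Nonempty) (hQ : Q.Nonempty)
    (hPQ : Disjoint P Q) (haP : ∀ i, 0 < i → i < n → ∀ z ∈ P, a ^ i • z ∈ Q)
    (hbQ : ∀ m : ℤ, m ≠ 0 → ∀ z ∈ Q, b ^ m • z ∈ P) :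
    GenerateFreeProduct n a b := by
  have : NeZero n := ⟨by omega⟩
  have hpow : ∀ x : Multiplicative (ZMod n),
      x = Multiplicative.ofAdd 1 ^ (Multiplicative.toAdd x).val := by
    intro x
    rw [← ofAdd_nsmul, nsmul_one, ZMod.natCast_zmod_val, ofAdd_toAdd]
  have hgen : ∀ x : Multiplicative (ZMod n), x ∈ Subgroup.zpowers (Multiplicative.ofAdd 1) :=
    fun x => hpow x ▸ Subgroup.npow_mem_zpowers _ _
  have hord : orderOf a ∣ orderOf (Multiplicative.ofAdd (1 : ZMod n)) := by
    rw [orderOf_ofAdd_eq_addOrderOf, ZMod.addOrderOf_one]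
    exact orderOf_dvd_of_pow_eq_one ha
  let f : Multiplicative (ZMod n) →* U := monoidHomOfForallMemZpowers hgen hord
  have hf : f (Multiplicative.ofAdd 1) = a := monoidHomOfForallMemZpowers_apply_gen hgen hord
  refine generateFreeProduct_of_injective (Monoid.Coprod.lift f (zpowersHom U b))
    (coprod_lift_injective_of_pingPong f _ ?_ hP hQ hPQ ?_ ?_) (by simpa using hf) (by simp)
  · have : Cardinal.mk (Multiplicative (ZMod n)) = n := by
      rw [Cardinal.mk_multiplicative, Cardinal.mk_fintype, ZMod.card]
    rw [this]
    exact_mod_cast hn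
  · intro x hx z hz
    rw [hpow x, map_pow, hf]
    refine haP _ (Nat.pos_of_ne_zero fun h0 => hx ?_) (ZMod.val_lt _) z hz
    rw [hpow x, h0, pow_zero]
  · intro y hy z hz
    rw [zpowersHom_apply]
    exact hbQ _ (fun h0 => hy (Multiplicative.toAdd.injective h0)) z hz

/-! ### Characters of nilpotent groups generated by two elements -/

theorem mem_zpowers_of_mem_zpowers_of_ne_one {K : Type*} [Group K] {p : ℕ} (hp : p.Prime) {h c : K}
    (ho : orderOf h = p) (hc : c ∈ Subgroup.zpowers h) (hc1 : c ≠ 1) :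
    h ∈ Subgroup.zpowers c := by
  obtain ⟨k, rfl⟩ := hc
  simp only at hc1 ⊢
  have hk : ¬ (p : ℤ) ∣ k := by
    rwa [← ho, orderOf_dvd_iff_zpow_eq_one]
  have hco : IsCoprime (p : ℤ) k := (Nat.prime_iff_prime_int.1 hp).coprime_iff_not_dvd.2 hk
  obtain ⟨a, b, hab⟩ := hco
  refine ⟨b, ?_⟩
  have : h ^ (a * p + b * k) = h := by rw [hab, zpow_one]
  rw [zpow_add, mul_comm a, zpow_mul, zpow_natCast, ← ho, pow_orderOf_eq_one, one_zpow, one_mul,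
    mul_comm, zpow_mul] at this
  exact this

/-- A normal subgroup of prime order of a nilpotent group is central. Indeed a nontrivial commutator
`⁅h, k⁆` would generate `⟨h⟩`, and so `h` would lie in every term of the lower central series. -/
theorem exists_notMem_normalizer_zpowers {K : Type*} [Group K] [Group.IsNilpotent K] {p : ℕ}
    (hp : p.Prime) {h : K} (ho : orderOf h = p) (hc : h ∉ Subgroup.center K) :
    ∃ g : K, g ∉ Subgroup.normalizer (Subgroup.zpowers h : Set K) := by
  by_contra! hn
  obtain ⟨k, hk⟩ : ∃ k, k * h ≠ h * k := by
    simpa [Subgroup.mem_center_iff] using hc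
  have hcomm : ⁅h, k⁆ ∈ Subgroup.zpowers h := by
    rw [commutatorElement_def, mul_assoc, mul_assoc]
    refine mul_mem (Subgroup.mem_zpowers h) ?_
    rw [← mul_assoc]
    exact (Subgroup.mem_normalizer_iff.1 (hn k) _).1 (inv_mem (Subgroup.mem_zpowers h))
  have hcomm1 : ⁅h, k⁆ ≠ 1 := fun h1 => hk (commutatorElement_eq_one_iff_mul_comm.1 h1).symm
  have hall : ∀ n, h ∈ Subgroup.lowerCentralSeries (⊤ : Subgroup K) n := by
    intro n
    induction n with
    | zero => simp
    | succ n ih =>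
      rw [Subgroup.lowerCentralSeries_succ]
      exact Subgroup.zpowers_le.2 (Subgroup.commutator_mem_commutator ih (Subgroup.mem_top k))
        (mem_zpowers_of_mem_zpowers_of_ne_one hp ho hcomm hcomm1)
  obtain ⟨n, hbot⟩ := Subgroup.nilpotent_iff_lowerCentralSeries.1 ‹Group.IsNilpotent K›
  have h1 : h = 1 := by simpa [hbot] using hall n
  rw [h1, orderOf_one] at ho
  exact hp.one_lt.ne ho

/-- In a nilpotent group a maximal subgroup containing `a` is normal, and here the
quotient by it is generated by the image of `b`, hence cyclic of order `p`. -/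
theorem exists_character_of_closure_pair_eq_top {K : Type*} [Group K] [Finite K]
    [Group.IsNilpotent K] {p : ℕ} (hp : p.Prime) {a b : K} (hb : orderOf b = p)
    (hab : b ∉ Subgroup.zpowers a) (hgen : Subgroup.closure {a, b} = ⊤)
    {R : Type*} [Group R] {ζ : R} (hζ : ζ ^ p = 1) :
    ∃ χ : K →* R, χ a = 1 ∧ χ b = ζ := by
  have hne : Subgroup.zpowers a ≠ ⊤ := fun h => hab (h ▸ Subgroup.mem_top b)
  obtain ⟨N, hN, haN⟩ := (eq_top_or_exists_le_coatom (Subgroup.zpowers a)).resolve_left hne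
  have : N.Normal := Subgroup.NormalizerCondition.normal_of_coatom _
    Group.normalizerCondition_of_isNilpotent hN
  have ha : a ∈ N := haN (Subgroup.mem_zpowers a)
  have hbN : b ∉ N := by
    intro hbN
    refine hN.1 (top_le_iff.1 (hgen ▸ (Subgroup.closure_le N).2 ?_))
    rintro _ (rfl | rfl) <;> assumption
  have hq : ∀ x : K ⧸ N, x ∈ Subgroup.zpowers (b : K ⧸ N) := by
    have hle : Subgroup.closure {a, b} ≤
        (Subgroup.zpowers (b : K ⧸ N)).comap (QuotientGroup.mk' N) := by
      rw [Subgroup.closure_le]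
      intro x hx
      rcases hx with hx | hx
      · have : QuotientGroup.mk' N x = 1 := (QuotientGroup.eq_one_iff x).2 (hx ▸ ha)
        exact Subgroup.mem_comap.2 (this ▸ one_mem _)
      · exact hx ▸ Subgroup.mem_zpowers _
    intro x
    obtain ⟨y, rfl⟩ := QuotientGroup.mk_surjective x
    exact hle (hgen ▸ Subgroup.mem_top y)
  have hord : orderOf (b : K ⧸ N) = p := by
    refine ((Nat.dvd_prime hp).1 ?_).resolve_left ?_
    · exact hb ▸ orderOf_map_dvd (QuotientGroup.mk' N) b
    · rw [orderOf_eq_one_iff]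
      exact fun h => hbN ((QuotientGroup.eq_one_iff b).1 h)
  have hdvd : orderOf ζ ∣ orderOf (b : K ⧸ N) := hord ▸ orderOf_dvd_of_pow_eq_one hζ
  refine ⟨(monoidHomOfForallMemZpowers hq hdvd).comp (QuotientGroup.mk' N), ?_, ?_⟩
  · have : QuotientGroup.mk' N a = 1 := (QuotientGroup.eq_one_iff a).2 ha
    rw [MonoidHom.comp_apply, this, map_one]
  · exact monoidHomOfForallMemZpowers_apply_gen hq hdvd

theorem conj_notMem_zpowers {G : Type*} [Group G] [Finite G] {g h : G}
    (hg : g ∉ Subgroup.normalizer (Subgroup.zpowers h : Set G)) :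
    g⁻¹ * h * g ∉ Subgroup.zpowers h := by
  intro hmem
  apply hg
  rw [← inv_mem_iff (x := g), Subgroup.mem_normalizer_iff_map_conj_eq]
  refine Subgroup.eq_of_le_of_card_ge ?_ ?_
  · rw [MonoidHom.map_zpowers, Subgroup.zpowers_le]
    simpa using hmem
  · exact (Subgroup.card_map_of_injective (MulAut.conj g⁻¹).injective).ge

/-! ### A common eigenvector in the regular representation -/

/-- The left regular representation of `G` on complex functions, `(k • f) t = f (k⁻¹ * t)`,
extended to `ℤ[G]`. -/
noncomputable def regularRep (G : Type*) [Group G] : ℤ[G] →ₐ[ℤ] Module.End ℂ (G → ℂ) :=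
  MonoidAlgebra.lift ℤ _ G
    { toFun := fun k => LinearMap.funLeft ℂ ℂ fun t => k⁻¹ * t
      map_one' := by ext; simp
      map_mul' := fun a b => by ext; simp [mul_assoc] }

theorem regularRep_emb_apply {G : Type*} [Group G] (k : G) (f : G → ℂ) (t : G) :
    regularRep G (emb k) f t = f (k⁻¹ * t) := by
  rw [regularRep, emb, MonoidAlgebra.lift_of]
  rfl

/-- A vector `x` fixed by `h` whose translate by `g` is an eigenvector of `h` with eigenvalue `ζ`. It
is the inverse of a character `χ` of `⟨h, g⁻¹ * h * g⟩` with `χ h = 1` and `χ (g⁻¹ * h * g) = ζ`,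
extended by zero to `G`. -/
theorem exists_eigenvector {G : Type*} [Group G] [Finite G] [Group.IsNilpotent G] {p : ℕ}
    (hp : p.Prime) {g h : G} (ho : orderOf h = p)
    (hg : g ∉ Subgroup.normalizer (Subgroup.zpowers h : Set G)) {ζ : ℂ} (hζ : ζ ^ p = 1) :
    ∃ x : G → ℂ, x ≠ 0 ∧ regularRep G (emb h) x = x ∧
      regularRep G (emb h) (regularRep G (emb g) x) = ζ • regularRep G (emb g) x := by
  classical
  set K := Subgroup.closure {h, g⁻¹ * h * g}
  have hhK : h ∈ K := Subgroup.subset_closure (by simp)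
  have hcK : g⁻¹ * h * g ∈ K := Subgroup.subset_closure (by simp)
  have hord : orderOf (⟨g⁻¹ * h * g, hcK⟩ : K) = p := by
    have : K.subtype ⟨g⁻¹ * h * g, hcK⟩ = MulAut.conj g⁻¹ h := by simp
    rw [← orderOf_injective K.subtype K.subtype_injective, this, MulEquiv.orderOf_eq, ho]
  have hnot : (⟨g⁻¹ * h * g, hcK⟩ : K) ∉ Subgroup.zpowers ⟨h, hhK⟩ := by
    rintro ⟨k, hk⟩
    exact conj_notMem_zpowers hg ⟨k, congrArg Subtype.val hk⟩
  have hgen : Subgroup.closure {(⟨h, hhK⟩ : K), ⟨g⁻¹ * h * g, hcK⟩} = ⊤ := by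
    rw [← Subgroup.closure_closure_coe_preimage (k := {h, g⁻¹ * h * g})]
    congr 1
    ext ⟨x, hx⟩
    simp
  have hζ0 : ζ ≠ 0 := by
    rintro rfl
    simp [hp.ne_zero] at hζ
  have hζu : Units.mk0 ζ hζ0 ^ p = 1 := by
    apply Units.ext
    simpa using hζ
  obtain ⟨χ, hχh, hχc⟩ := exists_character_of_closure_pair_eq_top hp hord hnot hgen hζu
  have hx : ∀ k : K, regularRep G (emb (k : G))
      (fun t => if ht : t ∈ K then ((χ ⟨t, ht⟩)⁻¹ : ℂˣ).val else (0 : ℂ)) =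
      (χ k : ℂ) • (fun t => if ht : t ∈ K then ((χ ⟨t, ht⟩)⁻¹ : ℂˣ).val else (0 : ℂ)) := by
    intro k
    ext t
    rw [regularRep_emb_apply, Pi.smul_apply]
    by_cases ht : t ∈ K
    · have ht' : (k : G)⁻¹ * t ∈ K := mul_mem (inv_mem k.2) ht
      have e : (⟨(k : G)⁻¹ * t, ht'⟩ : K) = k⁻¹ * ⟨t, ht⟩ := rfl
      rw [dif_pos ht, dif_pos ht', e, map_mul, map_inv, mul_inv, inv_inv, Units.val_mul,
        smul_eq_mul]
    · have ht' : (k : G)⁻¹ * t ∉ K := fun h' => ht ((mul_mem_cancel_left (inv_mem k.2)).1 h')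
      rw [dif_neg ht, dif_neg ht', smul_zero]
  refine ⟨fun t => if ht : t ∈ K then ((χ ⟨t, ht⟩)⁻¹ : ℂˣ).val else (0 : ℂ), ?_, ?_, ?_⟩
  · intro h0
    have := congrFun h0 1
    simp only [one_mem, dif_pos, Pi.zero_apply] at this
    exact Units.ne_zero _ this
  · rw [hx ⟨h, hhK⟩, hχh]
    simp
  · have e : h * g = g * (g⁻¹ * h * g) := by group
    rw [← Module.End.mul_apply, ← map_mul, ← map_mul, e, map_mul, map_mul, Module.End.mul_apply,
      hx ⟨_, hcK⟩, hχc, map_smul]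
    simp

/-! ### Ping-pong in the plane -/

/-- The bound comes from `p = ∑ j < p, (1 - η ^ j)` and `‖1 - η ^ j‖ ≤ j * ‖1 - η‖`, which give
`‖1 - η‖ ≥ 2 / (p - 1)`. -/
theorem two_lt_mul_norm_one_sub {p : ℕ} (hp : 2 ≤ p) {η : ℂ} (hη : η ^ p = 1) (hη1 : η ≠ 1) :
    2 < p * ‖1 - η‖ := by
  have hnorm : ‖η‖ = 1 := Complex.norm_eq_one_of_pow_eq_one hη (by omega)
  have hgeom : ∑ j ∈ Finset.range p, η ^ j = 0 := by
    have := geom_sum_mul η p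
    rw [hη, sub_self] at this
    exact (mul_eq_zero.1 this).resolve_right (sub_ne_zero.2 hη1)
  have hsum : (p : ℂ) = ∑ j ∈ Finset.range p, (1 - η ^ j) := by
    rw [Finset.sum_sub_distrib, hgeom]
    simp
  have hterm : ∀ j : ℕ, ‖1 - η ^ j‖ ≤ j * ‖1 - η‖ := by
    intro j
    induction j with
    | zero => simp
    | succ j ih =>
      have e : 1 - η ^ (j + 1) = (1 - η ^ j) + η ^ j * (1 - η) := by ring
      have hle := norm_add_le (1 - η ^ j) (η ^ j * (1 - η))
      rw [norm_mul, norm_pow, hnorm, one_pow, one_mul, ← e] at hle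
      push_cast
      linarith
  have hle : (p : ℝ) ≤ (∑ j ∈ Finset.range p, (j : ℝ)) * ‖1 - η‖ := by
    rw [Finset.sum_mul]
    calc (p : ℝ) = ‖∑ j ∈ Finset.range p, (1 - η ^ j)‖ := by rw [← hsum]; simp
      _ ≤ _ := norm_sum_le_of_le _ fun j _ => hterm j
  have hgauss : (∑ j ∈ Finset.range p, (j : ℝ)) * 2 = p * (p - 1) := by
    have h := Finset.sum_range_id_mul_two p
    have h' : ((∑ j ∈ Finset.range p, j : ℕ) : ℝ) * 2 = p * ((p - 1 : ℕ) : ℝ) := by exact_mod_cast h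
    rw [Nat.cast_sub (by omega)] at h'
    push_cast at h'
    exact h'
  have hp0 : (0 : ℝ) < p := by positivity
  have hpos : 0 < ‖1 - η‖ := norm_pos_iff.2 (sub_ne_zero.2 hη1.symm)
  have h2 : (p : ℝ) * 2 ≤ p * ((p - 1) * ‖1 - η‖) := by
    calc (p : ℝ) * 2 ≤ (∑ j ∈ Finset.range p, (j : ℝ)) * ‖1 - η‖ * 2 := by linarith
      _ = (∑ j ∈ Finset.range p, (j : ℝ)) * 2 * ‖1 - η‖ := by ring
      _ = _ := by rw [hgauss]; ring
  have h3 := le_of_mul_le_mul_left h2 hp0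
  rw [sub_mul, one_mul] at h3
  linarith

/-- A ping-pong criterion on the plane spanned by `x` and `y`, phrased in terms of the slope `β / α` of
`α • x + β • y`. The powers of `r` are rotations `s ↦ η * s + d` of the complex line of slopes, and
`v` is a Möbius transformation of determinant `conj ζ`. The disc `‖A‖ ≤ ‖α‖`, where `A` is the first
coordinate after applying `v`, is bounded by the isometric circle of `v`, and `‖A'‖ ≤ ‖α‖` is the
corresponding disc for `v⁻¹`. The bound `hcζ` makes these discs disjoint, both lie in
`‖s‖ ≤ 1 / ‖c‖`, and since `2 / ‖c‖ < ‖d‖` the rotations move them off themselves. -/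
theorem generateFreeProduct_of_planar_action {U V : Type*} [Group U] [AddCommGroup V] [Module ℂ V]
    (ρ : U →* Module.End ℂ V) {x y : V} (hxy : LinearIndependent ℂ ![x, y]) {n : ℕ} (hn : 3 ≤ n)
    {r v : U} (hr : r ^ n = 1) {c ζ : ℂ} (hζ : ‖ζ‖ = 1) (hc : c ≠ 0)
    (hcζ : 2 ≤ ‖c‖ ^ 2 * ‖1 + ζ‖)
    (hrot : ∀ i, 0 < i → i < n → ∃ d η : ℂ, ‖η‖ = 1 ∧ 2 < ‖d‖ * ‖c‖ ∧
      ∀ α β : ℂ, ρ (r ^ i) (α • x + β • y) = α • x + (d * α + η * β) • y)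
    (hv : ∀ α β : ℂ, ρ v (α • x + β • y) =
      (((‖c‖ ^ 2 + 1 : ℝ) : ℂ) * α + conj c * ((‖c‖ ^ 2 + 2 : ℝ) : ℂ) * β) • x +
        (conj ζ * (c * α + ((‖c‖ ^ 2 + 1 : ℝ) : ℂ) * β)) • y) :
    GenerateFreeProduct n r v := by
  set N : ℝ := ‖c‖ ^ 2 with hN
  have hN0 : 0 < N := by positivity
  have hcpos : 0 < ‖c‖ := norm_pos_iff.2 hc
  have hcN : c * conj c = (N : ℂ) := by rw [hN, Complex.mul_conj, Complex.normSq_eq_norm_sq]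
  have hζζ : ζ * conj ζ = 1 := by
    rw [Complex.mul_conj, Complex.normSq_eq_norm_sq, hζ]; simp
  let A : ℂ → ℂ → ℂ := fun α β => ((N + 1 : ℝ) : ℂ) * α + conj c * ((N + 2 : ℝ) : ℂ) * β
  let A' : ℂ → ℂ → ℂ := fun α β => ((N + 1 : ℝ) : ℂ) * α - ζ * (conj c * ((N + 2 : ℝ) : ℂ) * β)
  have hn1 : ∀ α : ℂ, ‖((N + 1 : ℝ) : ℂ) * α‖ = (N + 1) * ‖α‖ := fun α => by
    rw [norm_mul, Complex.norm_real, Real.norm_of_nonneg (by positivity)]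
  have hn2 : ∀ β : ℂ, ‖conj c * ((N + 2 : ℝ) : ℂ) * β‖ = (N + 2) * (‖c‖ * ‖β‖) := fun β => by
    rw [norm_mul, norm_mul, Complex.norm_real, Real.norm_of_nonneg (by positivity),
      RCLike.norm_conj]
    ring
  have hn3 : ∀ β : ℂ, ‖ζ * (conj c * ((N + 2 : ℝ) : ℂ) * β)‖ = (N + 2) * (‖c‖ * ‖β‖) := fun β => by
    rw [norm_mul, hζ, one_mul, hn2]
  -- The Cayley-Hamilton identity for `v`, read off on the first coordinate.
  have htrace : ∀ α β, ‖α‖ * 2 ≤ ‖A α β‖ + ‖A' α β‖ := by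
    intro α β
    have e : (1 + ζ) * (((N + 1 : ℝ) : ℂ) * α) = ζ * A α β + A' α β := by simp only [A, A']; ring
    have hle := norm_add_le (ζ * A α β) (A' α β)
    rw [← e, norm_mul, hn1, norm_mul, hζ, one_mul] at hle
    have : 2 ≤ (N + 1) * ‖1 + ζ‖ := by
      have := norm_nonneg (1 + ζ)
      linarith
    calc ‖α‖ * 2 ≤ ‖α‖ * ((N + 1) * ‖1 + ζ‖) := by gcongr
      _ = ‖1 + ζ‖ * ((N + 1) * ‖α‖) := by ring
      _ ≤ _ := hle
  have hpair := LinearIndependent.pair_iff.1 hxy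
  have hinj : ∀ {α β α' β' : ℂ}, α • x + β • y = α' • x + β' • y → α = α' ∧ β = β' := by
    intro α β α' β' h
    have := hpair (α - α') (β - β') (by
      rw [sub_smul, sub_smul, sub_add_sub_comm, h, sub_self])
    exact ⟨sub_eq_zero.1 this.1, sub_eq_zero.1 this.2⟩
  let _ : MulAction U V := MulAction.compHom V ρ
  have hsmul : ∀ (s : U) (z : V), s • z = ρ s z := fun _ _ => rfl
  have hvA : ∀ α β : ℂ, v • (α • x + β • y) =
      A α β • x + (conj ζ * (c * α + ((N + 1 : ℝ) : ℂ) * β)) • y := hv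
  have hA'v : ∀ α β : ℂ, A' (A α β) (conj ζ * (c * α + ((N + 1 : ℝ) : ℂ) * β)) = α := by
    intro α β
    simp only [A, A']
    push_cast
    linear_combination (-(N + 2 : ℂ) * α) * hcN
      - (conj c * (N + 2) * (c * α + (N + 1) * β)) * hζζ
  have hvA' : ∀ α β : ℂ, v⁻¹ • (α • x + β • y) =
      A' α β • x + (ζ * ((N + 1 : ℝ) : ℂ) * β - c * α) • y := by
    intro α β
    rw [inv_smul_eq_iff, hvA]
    congr 2
    · simp only [A, A']
      push_cast
      linear_combination ((N + 2 : ℂ) * α) * hcN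
    · simp only [A']
      push_cast
      linear_combination ((N + 2 : ℂ) * β) * conj ζ * ζ * hcN - β * hζζ
  have hAv : ∀ α β : ℂ, A (A' α β) (ζ * ((N + 1 : ℝ) : ℂ) * β - c * α) = α := by
    intro α β
    simp only [A, A']
    push_cast
    linear_combination (-(N + 2 : ℂ) * α) * hcN
  -- `S₁` and `S₂` are the open discs of `v` and `v⁻¹`, and `Q` is the complement of the closed ones.
  -- The strict inequalities exclude the zero vector, on which both sides vanish.
  let S₁ : Set V := {z | ∃ α β : ℂ, z = α • x + β • y ∧ ‖A α β‖ < ‖α‖}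
  let S₂ : Set V := {z | ∃ α β : ℂ, z = α • x + β • y ∧ ‖A' α β‖ < ‖α‖}
  let Q : Set V := {z | ∃ α β : ℂ, z = α • x + β • y ∧ ‖α‖ < ‖A α β‖ ∧ ‖α‖ < ‖A' α β‖}
  have hstep : ∀ α β : ℂ, ‖α‖ < ‖A α β‖ → v • (α • x + β • y) ∈ S₂ := fun α β h =>
    ⟨_, _, hvA α β, by rwa [hA'v]⟩
  have hstep' : ∀ α β : ℂ, ‖α‖ < ‖A' α β‖ → v⁻¹ • (α • x + β • y) ∈ S₁ := fun α β h =>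
    ⟨_, _, hvA' α β, by rwa [hAv]⟩
  have hpos : ∀ m : ℕ, ∀ z ∈ Q, v ^ (m + 1) • z ∈ S₂ := by
    rintro m z ⟨α, β, rfl, h₁, -⟩
    induction m with
    | zero => simpa using hstep α β h₁
    | succ m ih =>
      obtain ⟨α', β', e, h'⟩ := ih
      rw [pow_succ', mul_smul, e]
      refine hstep α' β' ?_
      have := htrace α' β'
      linarith
  have hneg : ∀ m : ℕ, ∀ z ∈ Q, v⁻¹ ^ (m + 1) • z ∈ S₁ := by
    rintro m z ⟨α, β, rfl, -, h₁⟩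
    induction m with
    | zero => simpa using hstep' α β h₁
    | succ m ih =>
      obtain ⟨α', β', e, h'⟩ := ih
      rw [pow_succ', mul_smul, e]
      refine hstep' α' β' ?_
      have := htrace α' β'
      linarith
  have hQ : (0 : ℂ) • x + (1 : ℂ) • y ∈ Q := by
    have : 0 < (N + 2) * (‖c‖ * ‖(1 : ℂ)‖) := by rw [norm_one]; positivity
    refine ⟨0, 1, rfl, ?_, ?_⟩
    · simpa only [A, mul_zero, zero_add, norm_zero, hn2] using this
    · simpa only [A', mul_zero, zero_sub, norm_neg, norm_zero, hn3] using this
  refine generateFreeProduct_of_pingPong hn hr (P := S₁ ∪ S₂) (Q := Q)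
    ⟨_, Or.inr (hpos 0 _ hQ)⟩ ⟨_, hQ⟩ ?_ ?_ ?_
  · rw [Set.disjoint_left]
    rintro _ (⟨α, β, rfl, h⟩ | ⟨α, β, rfl, h⟩) ⟨α', β', e, h₁, h₂⟩
    · obtain ⟨rfl, rfl⟩ := hinj e
      exact lt_asymm h h₁
    · obtain ⟨rfl, rfl⟩ := hinj e
      exact lt_asymm h h₂
  · intro i hi hin z hz
    obtain ⟨d, η, hη, hd, hact⟩ := hrot i hi hin
    -- Points in the discs have small slope, which the rotation makes large.
    obtain ⟨α, β, rfl, hα, hβ⟩ : ∃ α β : ℂ, z = α • x + β • y ∧ 0 < ‖α‖ ∧ ‖c‖ * ‖β‖ < ‖α‖ := by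
      have key : ∀ α β : ℂ, (N + 2) * (‖c‖ * ‖β‖) < (N + 2) * ‖α‖ → ‖c‖ * ‖β‖ < ‖α‖ :=
        fun α β h => lt_of_mul_lt_mul_left h (by positivity)
      rcases hz with ⟨α, β, rfl, h⟩ | ⟨α, β, rfl, h⟩
      · refine ⟨α, β, rfl, (norm_nonneg _).trans_lt h, key α β ?_⟩
        have := norm_sub_le (A α β) (((N + 1 : ℝ) : ℂ) * α)
        rw [hn1, show A α β - ((N + 1 : ℝ) : ℂ) * α = conj c * ((N + 2 : ℝ) : ℂ) * β by
          simp only [A]; ring, hn2] at this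
        linarith
      · refine ⟨α, β, rfl, (norm_nonneg _).trans_lt h, key α β ?_⟩
        have := norm_sub_le (((N + 1 : ℝ) : ℂ) * α) (A' α β)
        rw [hn1, show ((N + 1 : ℝ) : ℂ) * α - A' α β = ζ * (conj c * ((N + 2 : ℝ) : ℂ) * β) by
          simp only [A']; ring, hn3] at this
        linarith
    have hlarge : ‖α‖ < ‖c‖ * ‖d * α + η * β‖ := by
      have h1 : ‖d‖ * ‖α‖ - ‖β‖ ≤ ‖d * α + η * β‖ := by
        have := norm_sub_le (d * α + η * β) (η * β)
        rw [add_sub_cancel_right, norm_mul, norm_mul, hη, one_mul] at this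
        linarith
      have h2 := mul_le_mul_of_nonneg_left h1 hcpos.le
      have h3 : 2 * ‖α‖ < ‖d‖ * ‖c‖ * ‖α‖ := by gcongr
      linarith
    have hlarge' := mul_lt_mul_of_pos_left hlarge (show 0 < N + 2 by positivity)
    refine ⟨α, d * α + η * β, hact α β, ?_, ?_⟩
    · have := norm_sub_le (A α (d * α + η * β)) (((N + 1 : ℝ) : ℂ) * α)
      rw [hn1, show A α (d * α + η * β) - ((N + 1 : ℝ) : ℂ) * α =
        conj c * ((N + 2 : ℝ) : ℂ) * (d * α + η * β) by simp only [A]; ring, hn2] at this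
      linarith
    · have := norm_sub_le (((N + 1 : ℝ) : ℂ) * α) (A' α (d * α + η * β))
      rw [hn1, show ((N + 1 : ℝ) : ℂ) * α - A' α (d * α + η * β) =
        ζ * (conj c * ((N + 2 : ℝ) : ℂ) * (d * α + η * β)) by simp only [A']; ring, hn3] at this
      linarith
  · intro m hm z hz
    rcases lt_or_gt_of_ne hm with h | h
    · obtain ⟨k, rfl⟩ : ∃ k : ℕ, m = -((k + 1 : ℕ) : ℤ) := ⟨(-m).toNat - 1, by omega⟩
      rw [zpow_neg, zpow_natCast, ← inv_pow]
      exact Or.inl (hneg k z hz)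
    · obtain ⟨k, rfl⟩ : ∃ k : ℕ, m = ((k + 1 : ℕ) : ℤ) := ⟨m.toNat - 1, by omega⟩
      rw [zpow_natCast]
      exact Or.inr (hpos k z hz)

/-! ### Powers of the Bovdi unit -/

theorem bovdiUnit_one_pow {G : Type*} [Group G] (g h : G) (n : ℕ) :
    ((bovdiUnit 1 g h ^ n : (ℤ[G])ˣ) : ℤ[G]) =
      emb (h ^ n) + (1 - emb (h ^ n)) * emb g * cyclicSum h := by
  have hs : ∀ k, cyclicSum h * emb (h ^ k) = cyclicSum h := by
    intro k
    induction k with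
    | zero => simp
    | succ k ih =>
      have h1 := cyclicSum_mul_one_sub h
      rw [mul_sub, mul_one, sub_eq_zero] at h1
      rw [pow_succ, map_mul, ← mul_assoc, ih, ← h1]
  induction n with
  | zero => simp
  | succ n ih =>
    have h1 : cyclicSum h * (1 - emb (h ^ n)) = 0 := by rw [mul_sub, mul_one, hs, sub_self]
    have hn := hs n
    rw [pow_succ', Units.val_mul, ih]
    simp only [bovdiUnit, pow_one]
    rw [pow_succ', map_mul]
    generalize emb (h ^ n) = a at *
    generalize emb h = b at *
    generalize cyclicSum h = s at *
    generalize emb g = t at *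
    have e : (b + (1 - b) * t * s) * (a + (1 - a) * t * s) =
        b * a + b * (1 - a) * t * s + (1 - b) * t * (s * a)
          + (1 - b) * t * (s * (1 - a)) * t * s := by noncomm_ring
    rw [e, h1, hn]
    noncomm_ring

theorem bovdiUnit_one_pow_orderOf {G : Type*} [Group G] (g h : G) :
    bovdiUnit 1 g h ^ orderOf h = 1 := by
  apply Units.ext
  rw [bovdiUnit_one_pow, pow_orderOf_eq_one]
  simp

/-! ### The action of the units on the plane -/

section Action

variable {G V : Type*} [Group G] [AddCommGroup V] [Module ℂ V] {ρ : ℤ[G] →ₐ[ℤ] Module.End ℂ V}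
  {g h : G} {x : V} {ζ : ℂ}

theorem apply_emb_pow {l : ℂ} {z : V} (hz : ρ (emb h) z = l • z) (i : ℕ) :
    ρ (emb (h ^ i)) z = l ^ i • z := by
  induction i with
  | zero => simp
  | succ i ih => rw [pow_succ, map_mul, map_mul, Module.End.mul_apply, hz, map_smul, ih, smul_smul,
      pow_succ']

theorem apply_emb_inv {l : ℂ} (hl : l ≠ 0) {z : V} (hz : ρ (emb h) z = l • z) :
    ρ (emb h⁻¹) z = l⁻¹ • z := by
  have e : ρ (emb h⁻¹) (ρ (emb h) z) = z := by
    rw [← Module.End.mul_apply, ← map_mul, ← map_mul, inv_mul_cancel, map_one, map_one,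
      Module.End.one_apply]
  rw [hz, map_smul] at e
  rw [← e, smul_smul, inv_mul_cancel₀ hl, one_smul, e]

theorem apply_cyclicSum {l : ℂ} {z : V} (hz : ρ (emb h) z = l • z) :
    ρ (cyclicSum h) z = (∑ i ∈ Finset.range (orderOf h), l ^ i) • z := by
  rw [cyclicSum, map_sum, LinearMap.sum_apply, Finset.sum_smul]
  exact Finset.sum_congr rfl fun i _ => apply_emb_pow hz i

theorem apply_cyclicSum_of_fixed (hx : ρ (emb h) x = x) :
    ρ (cyclicSum h) x = (orderOf h : ℂ) • x := by
  rw [apply_cyclicSum (l := 1) (by rw [hx, one_smul])]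
  simp

theorem apply_cyclicSum_of_eigenvector {z : V} (hz : ρ (emb h) z = ζ • z)
    (hζ : ζ ^ orderOf h = 1) (hζ1 : ζ ≠ 1) : ρ (cyclicSum h) z = 0 := by
  have := geom_sum_mul ζ (orderOf h)
  rw [hζ, sub_self] at this
  rw [apply_cyclicSum hz, (mul_eq_zero.1 this).resolve_right (sub_ne_zero.2 hζ1), zero_smul]

theorem involution_add (a b : ℤ[G]) : involution (a + b) = involution a + involution b := by
  simp [involution, MonoidAlgebra.mapDomain_add]

theorem involution_sub (a b : ℤ[G]) : involution (a - b) = involution a - involution b := by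
  rw [eq_sub_iff_add_eq, ← involution_add, sub_add_cancel]

theorem involution_cyclicSum (h : G) : involution (cyclicSum h) = cyclicSum h⁻¹ := by
  have : ∀ s : Finset ℕ, involution (∑ i ∈ s, emb (h ^ i)) = ∑ i ∈ s, emb (h⁻¹ ^ i) := by
    intro s
    induction s using Finset.cons_induction with
    | empty => simp [involution]
    | cons a s ha ih =>
      rw [Finset.sum_cons, Finset.sum_cons, involution_add, ih, involution_emb, inv_pow]
  rw [cyclicSum, this, cyclicSum, orderOf_inv]

/-- On the plane spanned by `x` and `g x`, on which `h` acts as the diagonal matrix `(1, ζ)`, the Bovdi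
unit acts as a lower triangular matrix. -/
theorem apply_bovdiUnit (hx : ρ (emb h) x = x)
    (hy : ρ (emb h) (ρ (emb g) x) = ζ • ρ (emb g) x) (hζ : ζ ^ orderOf h = 1) (hζ1 : ζ ≠ 1)
    (k : ℕ) (α β : ℂ) :
    ρ (bovdiUnit k g h : ℤ[G]) (α • x + β • ρ (emb g) x) =
      α • x + (orderOf h * (1 - ζ) * α + ζ ^ k * β) • ρ (emb g) x := by
  have hx' : ρ (emb h) x = (1 : ℂ) • x := by rw [hx, one_smul]
  simp only [bovdiUnit, map_add, map_mul, map_sub, map_one, LinearMap.add_apply,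
    Module.End.mul_apply, LinearMap.sub_apply, Module.End.one_apply, map_smul,
    apply_cyclicSum_of_fixed hx, apply_cyclicSum_of_eigenvector hy hζ hζ1, apply_emb_pow hx',
    apply_emb_pow hy, hy, one_pow, one_smul, map_zero, add_zero]
  module

/-- The image of the Bovdi unit under the involution preserves the same plane and acts on it as the
conjugate transpose. -/
theorem apply_involutionUnit_bovdiUnit (hx : ρ (emb h) x = x)
    (hy : ρ (emb h) (ρ (emb g) x) = ζ • ρ (emb g) x) (hζ : ‖ζ‖ = 1) (α β : ℂ) :
    ρ (involutionUnit (bovdiUnit 1 g h) : ℤ[G]) (α • x + β • ρ (emb g) x) =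
      (α + conj (orderOf h * (1 - ζ)) * β) • x + (conj ζ * β) • ρ (emb g) x := by
  have hζ0 : ζ ≠ 0 := by
    rintro rfl
    simp at hζ
  have hx' : ρ (emb h) x = (1 : ℂ) • x := by rw [hx, one_smul]
  have hxi : ρ (emb h⁻¹) x = x := by simpa using apply_emb_inv one_ne_zero hx'
  have hyi := apply_emb_inv hζ0 hy
  have hgx : ρ (emb g⁻¹) (ρ (emb g) x) = x := by
    rw [← Module.End.mul_apply, ← map_mul, ← map_mul, inv_mul_cancel, map_one, map_one,
      Module.End.one_apply]
  have hconj : conj ζ = ζ⁻¹ := (Complex.inv_eq_conj hζ).symm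
  have hval : ((involutionUnit (bovdiUnit 1 g h) : (ℤ[G])ˣ) : ℤ[G]) =
      emb h⁻¹ + cyclicSum h⁻¹ * (emb g⁻¹ * (1 - emb h⁻¹)) := by
    simp only [involutionUnit, bovdiUnit, involution_add, involution_mul, involution_sub,
      involution_emb, involution_one, involution_cyclicSum, pow_one]
  have hs := apply_cyclicSum_of_fixed hxi
  rw [orderOf_inv] at hs
  rw [hval]
  simp only [map_add, map_mul, map_sub, map_one, LinearMap.add_apply,
    Module.End.mul_apply, LinearMap.sub_apply, Module.End.one_apply, map_smul, hxi, hyi, hgx, hs,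
    sub_self, map_zero, hconj, map_natCast]
  module

end Action

/-! ### The free products -/

section Planar

variable {G V : Type*} [Group G] [AddCommGroup V] [Module ℂ V] {ρ : ℤ[G] →ₐ[ℤ] Module.End ℂ V}
  {g h : G} {x : V} {ζ : ℂ}

theorem apply_involutionUnit_mul_mul (hx : ρ (emb h) x = x)
    (hy : ρ (emb h) (ρ (emb g) x) = ζ • ρ (emb g) x) (hζ : IsPrimitiveRoot ζ (orderOf h))
    (h3 : 3 ≤ orderOf h) {c : ℂ} (hc : c = orderOf h * (1 - ζ)) (α β : ℂ) :
    ρ ((involutionUnit (bovdiUnit 1 g h) * bovdiUnit 1 g h * involutionUnit (bovdiUnit 1 g h) :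
        (ℤ[G])ˣ) : ℤ[G]) (α • x + β • ρ (emb g) x) =
      (((‖c‖ ^ 2 + 1 : ℝ) : ℂ) * α + conj c * ((‖c‖ ^ 2 + 2 : ℝ) : ℂ) * β) • x +
        (conj ζ * (c * α + ((‖c‖ ^ 2 + 1 : ℝ) : ℂ) * β)) • ρ (emb g) x := by
  have hnorm : ‖ζ‖ = 1 := Complex.norm_eq_one_of_pow_eq_one hζ.pow_eq_one (by omega)
  have hN : c * conj c = ((‖c‖ ^ 2 : ℝ) : ℂ) := by rw [Complex.mul_conj, Complex.normSq_eq_norm_sq]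
  have hζζ : ζ * conj ζ = 1 := by
    rw [Complex.mul_conj, Complex.normSq_eq_norm_sq, hnorm]; simp
  rw [Units.val_mul, Units.val_mul, map_mul, map_mul, Module.End.mul_apply, Module.End.mul_apply,
    apply_involutionUnit_bovdiUnit hx hy hnorm,
    apply_bovdiUnit hx hy hζ.pow_eq_one (hζ.ne_one (by omega)),
    apply_involutionUnit_bovdiUnit hx hy hnorm, ← hc, pow_one]
  rw [Complex.ofReal_add, Complex.ofReal_add, ← hN]
  congr 2
  · push_cast
    linear_combination (conj c * β) * hζζ
  · push_cast
    linear_combination (conj ζ * β) * hζζ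

/-- The planar ping-pong criterion for the unit `u^* u u^*`, with `c = p (1 - ζ)`. -/
theorem generateFreeProduct_involutionUnit_mul_mul (hx0 : x ≠ 0) (hx : ρ (emb h) x = x)
    (hy : ρ (emb h) (ρ (emb g) x) = ζ • ρ (emb g) x) (hζ : IsPrimitiveRoot ζ (orderOf h))
    (h3 : 3 ≤ orderOf h) {r : (ℤ[G])ˣ} (hr : r ^ orderOf h = 1)
    (hrot : ∀ i, 0 < i → i < orderOf h → ∃ d η : ℂ, ‖η‖ = 1 ∧
      2 < ‖d‖ * ‖orderOf h * (1 - ζ)‖ ∧ ∀ α β : ℂ, ρ ((r ^ i : (ℤ[G])ˣ) : ℤ[G])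
        (α • x + β • ρ (emb g) x) = α • x + (d * α + η * β) • ρ (emb g) x) :
    GenerateFreeProduct (orderOf h) r
      (involutionUnit (bovdiUnit 1 g h) * bovdiUnit 1 g h *
        involutionUnit (bovdiUnit 1 g h)) := by
  have hζ1 : ζ ≠ 1 := hζ.ne_one (by omega)
  have hnorm : ‖ζ‖ = 1 := Complex.norm_eq_one_of_pow_eq_one hζ.pow_eq_one (by omega)
  have hζ2 : ζ ^ 2 ≠ 1 := fun e => by
    have := Nat.le_of_dvd (by norm_num) (hζ.dvd_of_pow_eq_one 2 e)
    omega
  have hb1 := two_lt_mul_norm_one_sub (by omega) hζ.pow_eq_one hζ1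
  have hb2 := two_lt_mul_norm_one_sub (by omega)
    (show (ζ ^ 2) ^ orderOf h = 1 by rw [← pow_mul, mul_comm, pow_mul, hζ.pow_eq_one, one_pow]) hζ2
  have hy0 : ρ (emb g) x ≠ 0 := fun e => hx0 <| by
    have : ρ (emb g⁻¹) (ρ (emb g) x) = x := by
      rw [← Module.End.mul_apply, ← map_mul, ← map_mul, inv_mul_cancel, map_one, map_one,
        Module.End.one_apply]
    rw [← this, e, map_zero]
  have hxy : LinearIndependent ℂ ![x, ρ (emb g) x] := by
    refine LinearIndependent.pair_iff.2 fun s t hst => ?_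
    -- Applying `h - 1` to the relation kills `x` and multiplies the other term by `ζ - 1`.
    have ht : t = 0 := by
      have h1 := congrArg (ρ (emb h)) hst
      rw [map_add, map_smul, map_smul, hx, hy, map_zero] at h1
      have h2 : (t * (ζ - 1)) • ρ (emb g) x = 0 := by
        have e : (t * (ζ - 1)) • ρ (emb g) x =
            (s • x + t • ζ • ρ (emb g) x) - (s • x + t • ρ (emb g) x) := by module
        rw [e, h1, hst, sub_zero]
      exact (mul_eq_zero.1 ((smul_eq_zero.1 h2).resolve_right hy0)).resolve_right
        (sub_ne_zero.2 hζ1)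
    rw [ht, zero_smul, add_zero] at hst
    exact ⟨(smul_eq_zero.1 hst).resolve_right hx0, ht⟩
  refine generateFreeProduct_of_planar_action
    ((ρ : ℤ[G] →* Module.End ℂ V).comp (Units.coeHom ℤ[G])) hxy h3 hr
    (c := orderOf h * (1 - ζ)) (ζ := ζ) hnorm ?_ ?_ hrot
    (apply_involutionUnit_mul_mul hx hy hζ h3 rfl)
  · rw [← norm_pos_iff, norm_mul, Complex.norm_natCast]
    linarith
  · -- `‖c‖ ^ 2 * ‖1 + ζ‖` is the product of the two quantities bounded by `hb1` and `hb2`.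
    rw [show (1 : ℂ) - ζ ^ 2 = (1 - ζ) * (1 + ζ) by ring, norm_mul] at hb2
    rw [norm_mul, Complex.norm_natCast]
    have := mul_lt_mul'' hb1 hb2 (by norm_num) (by norm_num)
    linarith

/-- On slopes, the Bovdi unit is multiplication by `ζ` around the centre `p`, so that its powers are
`s ↦ ζ ^ i * s + p * (1 - ζ ^ i)`. -/
theorem generateFreeProduct_bovdiUnit (hx0 : x ≠ 0) (hx : ρ (emb h) x = x)
    (hy : ρ (emb h) (ρ (emb g) x) = ζ • ρ (emb g) x) (hζ : IsPrimitiveRoot ζ (orderOf h))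
    (h3 : 3 ≤ orderOf h) :
    GenerateFreeProduct (orderOf h) (bovdiUnit 1 g h)
      (involutionUnit (bovdiUnit 1 g h) * bovdiUnit 1 g h *
        involutionUnit (bovdiUnit 1 g h)) := by
  have hnorm : ‖ζ‖ = 1 := Complex.norm_eq_one_of_pow_eq_one hζ.pow_eq_one (by omega)
  have hζ1 : ζ ≠ 1 := hζ.ne_one (by omega)
  refine generateFreeProduct_involutionUnit_mul_mul hx0 hx hy hζ h3
    (bovdiUnit_one_pow_orderOf g h) fun i hi hin =>
      ⟨orderOf h * (1 - ζ ^ i), ζ ^ i, by rw [norm_pow, hnorm, one_pow], ?_, fun α β => ?_⟩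
  · have hb1 := two_lt_mul_norm_one_sub (by omega) hζ.pow_eq_one hζ1
    have hbi := two_lt_mul_norm_one_sub (by omega)
      (show (ζ ^ i) ^ orderOf h = 1 by rw [← pow_mul, mul_comm, pow_mul, hζ.pow_eq_one, one_pow])
      (hζ.pow_ne_one_of_pos_of_lt hi.ne' hin)
    rw [norm_mul, norm_mul, Complex.norm_natCast]
    have := mul_lt_mul'' hbi hb1 (by norm_num) (by norm_num)
    linarith
  · clear hi hin
    induction i with
    | zero => simp
    | succ i ih =>
      rw [pow_succ', Units.val_mul, map_mul, Module.End.mul_apply, ih,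
        apply_bovdiUnit hx hy hζ.pow_eq_one hζ1]
      congr 2
      ring

/-- The element `h` acts on slopes as a rotation around `0`, a point too close to the discs of
`v = u^* u u^*`. The unit `t = (1 + (1 - h) g h~) ^ p` acts as the translation by `p * c` with
`c = p * (1 - ζ)`, and conjugating by it moves the centre of rotation far enough away, so `w` can be
taken to be `t v t⁻¹`. -/
theorem exists_generateFreeProduct_trivialUnit (hx0 : x ≠ 0) (hx : ρ (emb h) x = x)
    (hy : ρ (emb h) (ρ (emb g) x) = ζ • ρ (emb g) x) (hζ : IsPrimitiveRoot ζ (orderOf h))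
    (h3 : 3 ≤ orderOf h) :
    ∃ w : (ℤ[G])ˣ, GenerateFreeProduct (orderOf h) (trivialUnit h) w := by
  have hnorm : ‖ζ‖ = 1 := Complex.norm_eq_one_of_pow_eq_one hζ.pow_eq_one (by omega)
  have hζ1 : ζ ≠ 1 := hζ.ne_one (by omega)
  set p := orderOf h with hp
  set c : ℂ := p * (1 - ζ) with hc
  set t : (ℤ[G])ˣ := bovdiUnit 0 g h ^ p
  have hact : ∀ α β : ℂ, ρ (t : ℤ[G]) (α • x + β • ρ (emb g) x) =
      α • x + (β + p * c * α) • ρ (emb g) x := by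
    have : ∀ (k : ℕ) (α β : ℂ), ρ ((bovdiUnit 0 g h ^ k : (ℤ[G])ˣ) : ℤ[G])
        (α • x + β • ρ (emb g) x) = α • x + (β + k * c * α) • ρ (emb g) x := by
      intro k α β
      induction k with
      | zero => simp
      | succ k ih =>
        rw [pow_succ', Units.val_mul, map_mul, Module.End.mul_apply, ih,
          apply_bovdiUnit hx hy hζ.pow_eq_one hζ1, ← hp, ← hc]
        congr 2
        push_cast
        ring
    exact this p
  have hact' : ∀ α β : ℂ, ρ ((t⁻¹ : (ℤ[G])ˣ) : ℤ[G]) (α • x + β • ρ (emb g) x) =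
      α • x + (β - p * c * α) • ρ (emb g) x := by
    intro α β
    have e := hact α (β - p * c * α)
    rw [sub_add_cancel] at e
    rw [← e, ← Module.End.mul_apply, ← map_mul, Units.inv_mul, map_one, Module.End.one_apply]
  have htriv : ∀ (i : ℕ), ((trivialUnit h ^ i : (ℤ[G])ˣ) : ℤ[G]) = emb (h ^ i) := fun i => by
    rw [← map_pow]
    rfl
  have hpow : ∀ i : ℕ, (t⁻¹ * trivialUnit h * t) ^ i = t⁻¹ * trivialUnit h ^ i * t := fun i => by
    simpa using conj_pow (i := i) (a := t⁻¹) (b := trivialUnit h)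
  have hfree := generateFreeProduct_involutionUnit_mul_mul (r := t⁻¹ * trivialUnit h * t) hx0 hx hy
    hζ h3 ?_ fun i hi hin => ⟨p * c * (ζ ^ i - 1), ζ ^ i, by rw [norm_pow, hnorm, one_pow], ?_,
      fun α β => ?_⟩
  · have := hfree.conj t
    rw [show t * (t⁻¹ * trivialUnit h * t) * t⁻¹ = trivialUnit h by group] at this
    exact ⟨_, this⟩
  · rw [hpow, ← map_pow, pow_orderOf_eq_one, map_one, mul_one, inv_mul_cancel]
  · have hb1 := two_lt_mul_norm_one_sub (by omega) hζ.pow_eq_one hζ1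
    have hbi := two_lt_mul_norm_one_sub (by omega)
      (show (ζ ^ i) ^ p = 1 by rw [← pow_mul, mul_comm, pow_mul, hζ.pow_eq_one, one_pow])
      (hζ.pow_ne_one_of_pos_of_lt hi.ne' hin)
    rw [← hp, ← hc, norm_mul, norm_mul, Complex.norm_natCast, norm_sub_rev]
    have hcn : 2 < ‖c‖ := by rwa [hc, norm_mul, Complex.norm_natCast]
    have h1 := mul_lt_mul'' hbi hcn (by norm_num) (by norm_num)
    have h2 := mul_lt_mul'' h1 hcn (by norm_num) (by norm_num)
    linarith
  · have hx' : ρ (emb h) x = (1 : ℂ) • x := by rw [hx, one_smul]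
    rw [hpow, Units.val_mul, Units.val_mul, htriv, map_mul, map_mul, Module.End.mul_apply,
      Module.End.mul_apply, hact, map_add, map_smul, map_smul, apply_emb_pow hx',
      apply_emb_pow hy, one_pow, one_smul, smul_smul, hact']
    congr 2
    ring

end Planar

end GroupRingUnits

theorem mainTheorem6 {G : Type*} [Group G] [Finite G] [Group.IsNilpotent G]
    (p : ℕ) (hp : p.Prime) (hp2 : p ≠ 2)
    (h : G) (hord : orderOf h = p) (hnc : h ∉ Subgroup.center G) :
    (∃ g : G, g ∉ Subgroup.normalizer (Subgroup.zpowers h : Set G)) ∧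
    (∀ g : G, g ∉ Subgroup.normalizer (Subgroup.zpowers h : Set G) →
      GroupRingUnits.GenerateFreeProduct p
        (GroupRingUnits.bovdiUnit 1 g h)
        (GroupRingUnits.involutionUnit (GroupRingUnits.bovdiUnit 1 g h) *
          GroupRingUnits.bovdiUnit 1 g h *
          GroupRingUnits.involutionUnit (GroupRingUnits.bovdiUnit 1 g h))) ∧
    (∃ w : (MonoidAlgebra ℤ G)ˣ,
      GroupRingUnits.GenerateFreeProduct p (GroupRingUnits.trivialUnit h) w) := by
  subst hord
  have h3 : 3 ≤ orderOf h := by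
    have := hp.two_le
    omega
  have hζ := Complex.isPrimitiveRoot_exp (orderOf h) hp.ne_zero
  have hex := GroupRingUnits.exists_notMem_normalizer_zpowers hp rfl hnc
  refine ⟨hex, fun g hg => ?_, ?_⟩
  · obtain ⟨x, hx0, hx, hy⟩ := GroupRingUnits.exists_eigenvector hp rfl hg hζ.pow_eq_one
    exact GroupRingUnits.generateFreeProduct_bovdiUnit hx0 hx hy hζ h3
  · obtain ⟨g, hg⟩ := hex
    obtain ⟨x, hx0, hx, hy⟩ := GroupRingUnits.exists_eigenvector hp rfl hg hζ.pow_eq_one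
    exact GroupRingUnits.exists_generateFreeProduct_trivialUnit hx0 hx hy hζ h3
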